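/- Let $A$ be a (not necessarily unital) C*-algebra and let $\mathcal U$ be a non-principal ultrafilter on $\mathbb N$. Let $A^{\mathcal U}=\ell^\infty(A)/c_{\mathcal U}(A)$ be the C*-algebra ultrapower, where $\ell^\infty(A)$ is the C*-algebra of bounded sequences in $A$ and $c_{\mathcal U}(A)=\{(a_n)\in\ell^\infty(A):\lim_{n\to\mathcal U}\|a_n\|=0\}$; write $(a_n)^{\mathcal U}$ for the class of $(a_n)$. A trace on a C*-algebra is a bounded positive linear functional $\tau$ with $\tau(ab)=\tau(ba)$ for all $a,b$; a tracial state is a trace of norm $1$; an extremal tracial state is an extreme point of the convex set of tracial states. A functional $\tau$ on $A^{\mathcal U}$ is the $\mathcal U$-limit of a sequence $(\sigma_n)$ of functionals on $A$ if $\tau((a_n)^{\mathcal U})=\lim_{n\to\mathcal U}\sigma_n(a_n)$ for all $(a_n)\in\ell^\infty(A)$. If $A$ has infinitely many extremal tracial states, then there is a trace on $A^{\mathcal U}$, which can be taken to be a tracial state, that is not the $\mathcal U$-limit of any sequence of traces on $A$. -/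

import Mathlib

open Filter Topology
open scoped ENNReal ComplexOrder

noncomputable section

/-! ### The ultrapower of a C⋆-algebra -/

namespace CStarUltrapower

variable (U : Ultrafilter ℕ) (A : Type*) [NonUnitalCStarAlgebra A]

/-- `c_U(A)`: the bounded sequences in `A` whose norms tend to `0` along `U`, as a subspace of
`ℓ^∞(A)`. -/
def nullSeq : Submodule ℂ (lp (fun _ : ℕ => A) ∞) where
  carrier := {a | Tendsto (fun n => ‖a n‖) U (𝓝 0)}
  zero_mem' := by simp
  add_mem' := by
    intro a b ha hb
    have h := Tendsto.add ha hb
    rw [add_zero] at h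
    exact squeeze_zero (fun n => norm_nonneg _) (fun n => norm_add_le (a n) (b n)) h
  smul_mem' := by
    intro c a ha
    have h := Tendsto.const_mul ‖c‖ ha
    rw [mul_zero] at h
    exact squeeze_zero (fun n => norm_nonneg _) (fun n => (norm_smul_le c (a n))) h

variable {U A}

theorem mem_nullSeq {a : lp (fun _ : ℕ => A) ∞} :
    a ∈ nullSeq U A ↔ Tendsto (fun n => ‖a n‖) U (𝓝 0) := Iff.rfl

theorem norm_coe_le (a : lp (fun _ : ℕ => A) ∞) (n : ℕ) : ‖a n‖ ≤ ‖a‖ :=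
  lp.norm_apply_le_norm ENNReal.top_ne_zero a n

theorem mul_mem_left (a : lp (fun _ : ℕ => A) ∞) {b : lp (fun _ : ℕ => A) ∞}
    (hb : b ∈ nullSeq U A) : a * b ∈ nullSeq U A := by
  have h := Tendsto.const_mul ‖a‖ (mem_nullSeq.1 hb)
  rw [mul_zero] at h
  refine squeeze_zero (fun n => norm_nonneg _) (fun n => ?_) h
  exact (norm_mul_le (a n) (b n)).trans
    (mul_le_mul_of_nonneg_right (norm_coe_le a n) (norm_nonneg _))

theorem mul_mem_right (b : lp (fun _ : ℕ => A) ∞) {a : lp (fun _ : ℕ => A) ∞}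
    (ha : a ∈ nullSeq U A) : a * b ∈ nullSeq U A := by
  have h := Tendsto.mul_const ‖b‖ (mem_nullSeq.1 ha)
  rw [zero_mul] at h
  refine squeeze_zero (fun n => norm_nonneg _) (fun n => ?_) h
  exact (norm_mul_le (a n) (b n)).trans
    (mul_le_mul_of_nonneg_left (norm_coe_le b n) (norm_nonneg _))

theorem star_mem {a : lp (fun _ : ℕ => A) ∞}
    (ha : a ∈ nullSeq U A) : star a ∈ nullSeq U A := by
  refine (mem_nullSeq.1 ha).congr (fun n => ?_)
  rw [lp.star_apply, norm_star]

instance isClosed_nullSeq : IsClosed (nullSeq U A : Set (lp (fun _ : ℕ => A) ∞)) := by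
  refine isClosed_of_closure_subset fun a ha => ?_
  refine mem_nullSeq.2 (Metric.tendsto_nhds.2 fun ε hε => ?_)
  obtain ⟨b, hb, hab⟩ := Metric.mem_closure_iff.1 ha (ε / 2) (half_pos hε)
  filter_upwards [Metric.tendsto_nhds.1 (mem_nullSeq.1 hb) (ε / 2) (half_pos hε)] with n hn
  simp only [dist_zero_right, norm_norm] at hn ⊢
  rw [dist_eq_norm] at hab
  have h1 : ‖a n - b n‖ ≤ ‖a - b‖ := norm_coe_le (a - b) n
  have h2 : ‖a n‖ ≤ ‖a n - b n‖ + ‖b n‖ := by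
    simpa using norm_add_le (a n - b n) (b n)
  linarith

end CStarUltrapower

/-- The ultrapower `A^U = ℓ^∞(A) / c_U(A)`. -/
def CStarUltrapower (U : Ultrafilter ℕ) (A : Type*) [NonUnitalCStarAlgebra A] : Type _ :=
  lp (fun _ : ℕ => A) ∞ ⧸ CStarUltrapower.nullSeq U A

namespace CStarUltrapower

variable {U : Ultrafilter ℕ} {A : Type*} [NonUnitalCStarAlgebra A]

/-- The quotient norm. -/
instance : NormedAddCommGroup (CStarUltrapower U A) :=
  inferInstanceAs (NormedAddCommGroup (lp (fun _ : ℕ => A) ∞ ⧸ nullSeq U A))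

instance : NormedSpace ℂ (CStarUltrapower U A) :=
  inferInstanceAs (NormedSpace ℂ (lp (fun _ : ℕ => A) ∞ ⧸ nullSeq U A))

instance : CompleteSpace (CStarUltrapower U A) :=
  inferInstanceAs (CompleteSpace (lp (fun _ : ℕ => A) ∞ ⧸ nullSeq U A))

/-- The quotient map `ℓ^∞(A) → A^U`. -/
def mk (U : Ultrafilter ℕ) (A : Type*) [NonUnitalCStarAlgebra A] :
    lp (fun _ : ℕ => A) ∞ →ₗ[ℂ] CStarUltrapower U A :=
  (nullSeq U A).mkQ

theorem mk_surjective (x : CStarUltrapower U A) : ∃ a, mk U A a = x :=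
  Submodule.mkQ_surjective (nullSeq U A) x

theorem mk_eq_mk {a b : lp (fun _ : ℕ => A) ∞} : mk U A a = mk U A b ↔ a - b ∈ nullSeq U A :=
  Submodule.Quotient.eq (nullSeq U A)

instance : Mul (CStarUltrapower U A) where
  mul := Quotient.map₂ (· * ·) (by
    intro a a' ha b b' hb
    have ha' := (Submodule.quotientRel_def (nullSeq U A)).1 ha
    have hb' := (Submodule.quotientRel_def (nullSeq U A)).1 hb
    refine (Submodule.quotientRel_def (nullSeq U A)).2 ?_
    have h : a * b - a' * b' = (a - a') * b + a' * (b - b') := by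
      rw [sub_mul, mul_sub]; abel
    simp only [h]
    exact add_mem (mul_mem_right b ha') (mul_mem_left a' hb'))

instance : Star (CStarUltrapower U A) where
  star := Quotient.map star (by
    intro a a' ha
    have ha' := (Submodule.quotientRel_def (nullSeq U A)).1 ha
    refine (Submodule.quotientRel_def (nullSeq U A)).2 ?_
    rw [← star_sub]
    exact star_mem ha')

theorem mk_mul (a b : lp (fun _ : ℕ => A) ∞) : mk U A (a * b) = mk U A a * mk U A b := rfl

theorem mk_star (a : lp (fun _ : ℕ => A) ∞) : mk U A (star a) = star (mk U A a) := rfl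

/-- The quotient norm of the class of `(a_n)` is `lim_{n → U} ‖a_n‖`. -/
theorem tendsto_norm (a : lp (fun _ : ℕ => A) ∞) :
    Tendsto (fun n => ‖a n‖) U (𝓝 ‖mk U A a‖) := by
  obtain ⟨L, -, hL⟩ := isCompact_Icc.ultrafilter_le_nhds
    (U.map fun n => ‖a n‖) (s := Set.Icc 0 ‖a‖)
    (by
      simp only [le_principal_iff, Ultrafilter.mem_coe, Ultrafilter.mem_map]
      exact Filter.univ_mem' fun n => ⟨norm_nonneg _, norm_coe_le a n⟩)
  have hL' : Tendsto (fun n => ‖a n‖) U (𝓝 L) := hL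
  suffices h : ‖mk U A a‖ = L by rwa [h]
  apply le_antisymm
  · refine le_of_forall_gt_imp_ge_of_dense fun c hc => ?_
    have hc0 : 0 ≤ c :=
      (ge_of_tendsto hL' (Filter.Eventually.of_forall fun n => norm_nonneg _)).trans hc.le
    classical
    let f : ℕ → A := fun n => if ‖a n‖ ≤ c then a n else 0
    have hf : ∀ n, ‖f n‖ ≤ c := by
      intro n
      by_cases h : ‖a n‖ ≤ c
      · simp [f, h]
      · simpa [f, h] using hc0
    let b : lp (fun _ : ℕ => A) ∞ :=
      ⟨f, memℓp_infty ⟨c, by rintro _ ⟨n, rfl⟩; exact hf n⟩⟩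
    have hab : mk U A a = mk U A b := by
      refine mk_eq_mk.2 (mem_nullSeq.2 ?_)
      refine Tendsto.congr' ?_ tendsto_const_nhds
      filter_upwards [hL'.eventually (gt_mem_nhds hc)] with n hn
      have : b n = a n := by
        change f n = a n
        simp [f, hn.le]
      change 0 = ‖a n - b n‖
      rw [this, sub_self, norm_zero]
    rw [hab]
    exact (Submodule.Quotient.norm_mk_le (nullSeq U A) b).trans
      (lp.norm_le_of_forall_le hc0 hf)
  · refine le_of_forall_pos_le_add fun ε hε => ?_
    obtain ⟨b, hb, hbn⟩ := Submodule.Quotient.norm_mk_lt (S := nullSeq U A) (mk U A a) hε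
    have hba : mk U A b = mk U A a := hb
    have hlim := (mem_nullSeq.1 (mk_eq_mk.1 hba)).add_const (‖mk U A a‖ + ε)
    rw [zero_add] at hlim
    refine le_of_tendsto_of_tendsto hL' hlim ?_
    refine Filter.Eventually.of_forall fun n => ?_
    change ‖a n‖ ≤ ‖b n - a n‖ + (‖mk U A a‖ + ε)
    have h1 := norm_coe_le b n
    have h2 : ‖a n‖ ≤ ‖b n - a n‖ + ‖b n‖ := by
      have := norm_sub_norm_le (a n) (b n)
      rw [norm_sub_rev] at this
      linarith
    have h3 : ‖b‖ < ‖mk U A a‖ + ε := hbn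
    linarith

instance : NonUnitalNormedRing (CStarUltrapower U A) where
  __ := (inferInstance : NormedAddCommGroup (CStarUltrapower U A))
  left_distrib x y z := by
    obtain ⟨a, rfl⟩ := mk_surjective x
    obtain ⟨b, rfl⟩ := mk_surjective y
    obtain ⟨c, rfl⟩ := mk_surjective z
    simp only [← map_add, ← mk_mul, mul_add]
  right_distrib x y z := by
    obtain ⟨a, rfl⟩ := mk_surjective x
    obtain ⟨b, rfl⟩ := mk_surjective y
    obtain ⟨c, rfl⟩ := mk_surjective z
    simp only [← map_add, ← mk_mul, add_mul]
  zero_mul x := by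
    obtain ⟨a, rfl⟩ := mk_surjective x
    rw [← map_zero (mk U A), ← mk_mul, zero_mul]
  mul_zero x := by
    obtain ⟨a, rfl⟩ := mk_surjective x
    rw [← map_zero (mk U A), ← mk_mul, mul_zero]
  mul_assoc x y z := by
    obtain ⟨a, rfl⟩ := mk_surjective x
    obtain ⟨b, rfl⟩ := mk_surjective y
    obtain ⟨c, rfl⟩ := mk_surjective z
    simp only [← mk_mul, mul_assoc]
  norm_mul_le x y := by
    obtain ⟨a, rfl⟩ := mk_surjective x
    obtain ⟨b, rfl⟩ := mk_surjective y
    rw [← mk_mul]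
    exact le_of_tendsto_of_tendsto (tendsto_norm (a * b))
      ((tendsto_norm a).mul (tendsto_norm b))
      (Filter.Eventually.of_forall fun n => norm_mul_le (a n) (b n))

instance : StarRing (CStarUltrapower U A) where
  star_involutive x := by
    obtain ⟨a, rfl⟩ := mk_surjective x
    rw [← mk_star, ← mk_star, star_star]
  star_mul x y := by
    obtain ⟨a, rfl⟩ := mk_surjective x
    obtain ⟨b, rfl⟩ := mk_surjective y
    simp only [← mk_star, ← mk_mul, star_mul]
  star_add x y := by
    obtain ⟨a, rfl⟩ := mk_surjective x
    obtain ⟨b, rfl⟩ := mk_surjective y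
    simp only [← mk_star, ← map_add, star_add]

/-- The ultrapower of a C⋆-algebra is a C⋆-algebra. -/
instance : NonUnitalCStarAlgebra (CStarUltrapower U A) where
  norm_mul_self_le x := by
    obtain ⟨a, rfl⟩ := mk_surjective x
    rw [← mk_star, ← mk_mul]
    exact le_of_tendsto_of_tendsto ((tendsto_norm a).mul (tendsto_norm a))
      (tendsto_norm (star a * a))
      (Filter.Eventually.of_forall fun n => CStarRing.norm_mul_self_le (a n))
  smul_assoc r x y := by
    obtain ⟨a, rfl⟩ := mk_surjective x
    obtain ⟨b, rfl⟩ := mk_surjective y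
    simp only [smul_eq_mul, ← map_smul, ← mk_mul, smul_mul_assoc]
  smul_comm r x y := by
    obtain ⟨a, rfl⟩ := mk_surjective x
    obtain ⟨b, rfl⟩ := mk_surjective y
    simp only [smul_eq_mul, ← map_smul, ← mk_mul, mul_smul_comm]
  star_smul r x := by
    obtain ⟨a, rfl⟩ := mk_surjective x
    simp only [← mk_star, ← map_smul, star_smul]

end CStarUltrapower

/-! ### Traces -/

/-- A trace on a C⋆-algebra: a (bounded) positive linear functional `φ` with
`φ (a * b) = φ (b * a)`. -/
structure IsTrace {B : Type*} [NonUnitalCStarAlgebra B] (φ : B →L[ℂ] ℂ) : Prop where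
  nonneg : ∀ a : B, 0 ≤ φ (star a * a)
  map_mul_comm : ∀ a b : B, φ (a * b) = φ (b * a)

/-- The set of tracial states: the traces of norm one. -/
def tracialStates (B : Type*) [NonUnitalCStarAlgebra B] : Set (B →L[ℂ] ℂ) :=
  {φ | IsTrace φ ∧ ‖φ‖ = 1}

/-- The extremal tracial states: the extreme points of the convex set of tracial states. -/
def extremalTracialStates (B : Type*) [NonUnitalCStarAlgebra B] : Set (B →L[ℂ] ℂ) :=
  (tracialStates B).extremePoints ℝ

/-- `τ` is the `U`-limit of the functionals `σ n`: `τ ((a_n)^U) = lim_{n → U} σ_n (a_n)` for every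
bounded sequence `(a_n)`. -/
def IsUltralimit {A : Type*} [NonUnitalCStarAlgebra A] (U : Ultrafilter ℕ)
    (σ : ℕ → A →L[ℂ] ℂ) (τ : CStarUltrapower U A →L[ℂ] ℂ) : Prop :=
  ∀ a : lp (fun _ : ℕ => A) ∞,
    Tendsto (fun n => σ n (a n)) U (𝓝 (τ (CStarUltrapower.mk U A a)))

end

/-!
Let `φ_j` be distinct extremal tracial states of `A`, let `ψ` be their limit along `U` and let `τ`
be the limit along `U` of the traces `(a_n)^U ↦ lim_n φ_j(a_n)`. Distinct extremal tracial states
are mutually singular. Hence either all of them are singular to `ψ`, or `ψ` dominates a multiple of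
one of them, to which the others are singular. Either way some contractions `e_k` satisfy
`ψ(e_k) ≤ α < β ≤ φ_j(e_k)` for all large `k`, for almost every `j`. If `τ` were the `U`-limit of
`σ_n`, then `σ_n(e_k)` would tend to `ψ(e_k) ≤ α` for each `k`, so that a diagonal sequence
`(e_{k(n)})` would have `τ`-value less than `β`; but its value is at least `β` under almost all of
the traces converging to `τ`.

Singular traces `φ, ψ` are separated by approximate Radon-Nikodym derivatives of `φ` with respect
to `s = φ + ψ`. These are positive contractions `a` which nearly minimize `s(a²) - 2 φ(a)`. They
are approximately central in the `2`-norm of `s`, so that limits of `ψ(a ·)` are again traces.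
Such a limit is dominated by both `φ` and `ψ`, hence zero.
-/

/-! ### Pointwise limits of functionals along an ultrafilter -/

theorem exists_norm_le_forall_tendsto {𝕜 ι E : Type*} [NontriviallyNormedField 𝕜] [ProperSpace 𝕜]
    [SeminormedAddCommGroup E] [NormedSpace 𝕜 E] (V : Ultrafilter ι) {f : ι → E →L[𝕜] 𝕜} {C : ℝ}
    (hf : ∀ i, ‖f i‖ ≤ C) :
    ∃ F : E →L[𝕜] 𝕜, ‖F‖ ≤ C ∧ ∀ x, Tendsto (fun i => f i x) V (𝓝 (F x)) := by
  obtain ⟨F, hF, hfF⟩ :=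
    (WeakDual.isCompact_closedBall (0 : StrongDual 𝕜 E) C).ultrafilter_le_nhds
      (V.map fun i => StrongDual.toWeakDual (f i))
      (tendsto_principal.2 <| .of_forall fun i => by simpa using hf i)
  exact ⟨WeakDual.toStrongDual F, by simpa using hF,
    fun x => ((WeakDual.eval_continuous x).tendsto F).comp hfF⟩

/-! ### Positive functionals -/

/-- The seminorm `‖a‖₂ = φ(a⋆a)^{1/2}` of a positive functional `φ`. -/
noncomputable def twoNorm {B : Type*} [NonUnitalCStarAlgebra B] (φ : B →L[ℂ] ℂ) (a : B) : ℝ :=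
  √(φ (star a * a)).re

theorem twoNorm_nonneg {B : Type*} [NonUnitalCStarAlgebra B] (φ : B →L[ℂ] ℂ) (a : B) :
    0 ≤ twoNorm φ a :=
  Real.sqrt_nonneg _

theorem re_apply_le_norm {E : Type*} [SeminormedAddCommGroup E] [NormedSpace ℂ E] (φ : E →L[ℂ] ℂ)
    {e : E} (he : ‖e‖ ≤ 1) : (φ e).re ≤ ‖φ‖ :=
  (Complex.re_le_norm _).trans (φ.unit_le_opNorm e he)

section PositiveFunctional

variable {B : Type*} [NonUnitalCStarAlgebra B] [PartialOrder B] {φ ψ : B →L[ℂ] ℂ}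

theorem apply_nonneg_of_monotone (hφ : Monotone φ) {a : B} (ha : 0 ≤ a) : 0 ≤ φ a := by
  simpa using hφ ha

theorem re_apply_nonneg_of_monotone (hφ : Monotone φ) {a : B} (ha : 0 ≤ a) : 0 ≤ (φ a).re :=
  (Complex.nonneg_iff.1 (apply_nonneg_of_monotone hφ ha)).1

theorem re_apply_le_of_monotone (hφ : Monotone φ) {a b : B} (hab : a ≤ b) :
    (φ a).re ≤ (φ b).re :=
  (Complex.le_def.1 (hφ hab)).1

variable [StarOrderedRing B]

theorem mul_self_le_self_of_norm_le_one {e : B} (he : 0 ≤ e) (he1 : ‖e‖ ≤ 1) : e * e ≤ e := by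
  obtain ⟨v, rfl⟩ := CStarAlgebra.nonneg_iff_eq_star_mul_self.1 he
  have hle : star v * (v * star v) * v ≤ ‖v * star v‖ • (star v * v) :=
    CStarAlgebra.star_left_conjugate_le_norm_smul
  rw [CStarRing.norm_self_mul_star, ← CStarRing.norm_star_mul_self] at hle
  calc star v * v * (star v * v) = star v * (v * star v) * v := by simp only [mul_assoc]
    _ ≤ ‖star v * v‖ • (star v * v) := hle
    _ ≤ (1 : ℝ) • (star v * v) := smul_le_smul_of_nonneg_right he1 he
    _ = star v * v := one_smul ℝ _

theorem apply_star_of_monotone (hφ : Monotone φ) (a : B) : φ (star a) = star (φ a) :=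
  StarHomClass.map_star (⟨φ, hφ⟩ : B →ₚ[ℂ] ℂ) a

theorem sq_twoNorm (hφ : Monotone φ) (a : B) : twoNorm φ a ^ 2 = (φ (star a * a)).re :=
  Real.sq_sqrt (re_apply_nonneg_of_monotone hφ (star_mul_self_nonneg a))

theorem norm_toPreGNS_eq_twoNorm (hφ : Monotone φ) (a : B) :
    ‖(⟨φ, hφ⟩ : B →ₚ[ℂ] ℂ).toPreGNS a‖ = twoNorm φ a :=
  PositiveLinearMap.preGNS_norm_def _ _

theorem norm_apply_star_mul_le (hφ : Monotone φ) (a b : B) :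
    ‖φ (star a * b)‖ ≤ twoNorm φ a * twoNorm φ b := by
  simp only [← norm_toPreGNS_eq_twoNorm hφ]
  exact norm_inner_le_norm (𝕜 := ℂ) ((⟨φ, hφ⟩ : B →ₚ[ℂ] ℂ).toPreGNS a) _

theorem twoNorm_le_of_monotone_sub (h : Monotone (ψ - φ)) (a : B) :
    twoNorm φ a ≤ twoNorm ψ a := by
  have hre := re_apply_nonneg_of_monotone h (star_mul_self_nonneg a)
  rw [sub_apply, Complex.sub_re, sub_nonneg] at hre
  exact Real.sqrt_le_sqrt hre

theorem twoNorm_sub_le (hφ : Monotone φ) (a b : B) :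
    twoNorm φ (a - b) ≤ twoNorm φ a + twoNorm φ b := by
  simp only [← norm_toPreGNS_eq_twoNorm hφ, map_sub]
  exact norm_sub_le _ _

theorem twoNorm_mul_le (hφ : Monotone φ) (a b : B) :
    twoNorm φ (a * b) ≤ ‖a‖ * twoNorm φ b := by
  refine Real.sqrt_le_iff.2 ⟨by positivity [twoNorm_nonneg φ b], ?_⟩
  have hle : star b * (star a * a) * b ≤ ‖star a * a‖ • (star b * b) :=
    CStarAlgebra.star_left_conjugate_le_norm_smul
  have hre := re_apply_le_of_monotone hφ hle
  rw [φ.map_smul_of_tower, Complex.smul_re, smul_eq_mul, CStarRing.norm_star_mul_self] at hre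
  rw [mul_pow, sq_twoNorm hφ, star_mul, ← mul_assoc, mul_assoc (star b), sq]
  exact hre

theorem twoNorm_sq_le_norm (hφ : Monotone φ) {a : B} (ha : ‖a‖ ≤ 1) : twoNorm φ a ^ 2 ≤ ‖φ‖ := by
  rw [sq_twoNorm hφ]
  refine re_apply_le_norm φ ?_
  rw [CStarRing.norm_star_mul_self]
  exact mul_le_one₀ ha (norm_nonneg a) ha

theorem tendsto_re_approximateUnit (hφ : Monotone φ) :
    Tendsto (fun u => (φ u).re) (CStarAlgebra.approximateUnit B) (𝓝 ‖φ‖) := by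
  have hunit := CStarAlgebra.increasingApproximateUnit B
  refine tendsto_order.2 ⟨fun c hc => ?_, fun c hc => ?_⟩
  · rcases (norm_nonneg φ).eq_or_lt with h0 | h0
    · filter_upwards [hunit.eventually_nonneg] with u hu
      exact (h0 ▸ hc).trans_le (re_apply_nonneg_of_monotone hφ hu)
    have hsqrt : √(c * ‖φ‖) < ‖φ‖ := (Real.sqrt_lt' h0).2 (by nlinarith)
    obtain ⟨x, hx1, hx⟩ := φ.exists_lt_apply_of_lt_opNorm hsqrt
    have hux : Tendsto (fun u => ‖φ (u * x)‖) (CStarAlgebra.approximateUnit B) (𝓝 ‖φ x‖) :=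
      ((φ.continuous.tendsto x).comp (hunit.tendsto_mul_right x)).norm
    filter_upwards [hunit.eventually_nonneg, hunit.eventually_norm, hux.eventually_const_lt hx]
      with u hu hu1 hlt
    have hstar : star u = u := (IsSelfAdjoint.of_nonneg hu).star_eq
    have huu : twoNorm φ u ^ 2 ≤ (φ u).re := by
      rw [sq_twoNorm hφ, hstar]
      exact re_apply_le_of_monotone hφ (mul_self_le_self_of_norm_le_one hu hu1)
    have hcs : ‖φ (u * x)‖ ≤ twoNorm φ u * twoNorm φ x := by
      simpa only [hstar] using norm_apply_star_mul_le hφ u x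
    refine lt_of_mul_lt_mul_right ?_ h0.le
    calc c * ‖φ‖ < ‖φ (u * x)‖ ^ 2 := Real.lt_sq_of_sqrt_lt hlt
      _ ≤ (twoNorm φ u * twoNorm φ x) ^ 2 := by gcongr
      _ = twoNorm φ u ^ 2 * twoNorm φ x ^ 2 := mul_pow _ _ _
      _ ≤ (φ u).re * ‖φ‖ := by
        gcongr
        exacts [(sq_nonneg _).trans huu, twoNorm_sq_le_norm hφ hx1.le]
  · filter_upwards [hunit.eventually_norm] with u hu1
    exact (re_apply_le_norm φ hu1).trans_lt hc

theorem norm_add_of_monotone (hφ : Monotone φ) (hψ : Monotone ψ) : ‖φ + ψ‖ = ‖φ‖ + ‖ψ‖ := by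
  have hadd : Monotone (φ + ψ) := hφ.add hψ
  refine tendsto_nhds_unique (tendsto_re_approximateUnit hadd) ?_
  simpa using (tendsto_re_approximateUnit hφ).add (tendsto_re_approximateUnit hψ)

theorem norm_add_norm_sub_of_monotone (hψ : Monotone ψ) (hφψ : Monotone (φ - ψ)) :
    ‖ψ‖ + ‖φ - ψ‖ = ‖φ‖ := by
  rw [← norm_add_of_monotone hψ hφψ, add_sub_cancel]

theorem norm_sum_of_monotone {ι : Type*} {f : ι → B →L[ℂ] ℂ} (s : Finset ι)
    (hf : ∀ i ∈ s, Monotone (f i)) : ‖∑ i ∈ s, f i‖ = ∑ i ∈ s, ‖f i‖ := by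
  have hsum : Monotone (∑ i ∈ s, f i : B →L[ℂ] ℂ) := fun a b hab => by
    simpa using Finset.sum_le_sum fun i hi => hf i hi hab
  refine tendsto_nhds_unique (tendsto_re_approximateUnit hsum) ?_
  simpa using tendsto_finsetSum s fun i hi => tendsto_re_approximateUnit (hf i hi)

end PositiveFunctional

/-! ### Traces -/

namespace IsTrace

variable {B : Type*} [NonUnitalCStarAlgebra B] {φ ψ : B →L[ℂ] ℂ}

theorem add (hφ : IsTrace φ) (hψ : IsTrace ψ) : IsTrace (φ + ψ) where
  nonneg a := add_nonneg (hφ.nonneg a) (hψ.nonneg a)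
  map_mul_comm a b := congrArg₂ (· + ·) (hφ.map_mul_comm a b) (hψ.map_mul_comm a b)

theorem sum {ι : Type*} {f : ι → B →L[ℂ] ℂ} (s : Finset ι) (hf : ∀ i ∈ s, IsTrace (f i)) :
    IsTrace (∑ i ∈ s, f i) where
  nonneg a := by simpa using Finset.sum_nonneg fun i hi => (hf i hi).nonneg a
  map_mul_comm a b := by simpa using Finset.sum_congr rfl fun i hi => (hf i hi).map_mul_comm a b

theorem smul (hφ : IsTrace φ) {c : ℝ} (hc : 0 ≤ c) : IsTrace (c • φ) where
  nonneg a := smul_nonneg hc (hφ.nonneg a)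
  map_mul_comm a b := congrArg (c • ·) (hφ.map_mul_comm a b)

theorem of_tendsto {ι : Type*} {l : Filter ι} [l.NeBot] {f : ι → B →L[ℂ] ℂ}
    (hf : ∀ i, IsTrace (f i)) (h : ∀ b, Tendsto (fun i => f i b) l (𝓝 (φ b))) : IsTrace φ where
  nonneg a := ge_of_tendsto' (h _) fun i => (hf i).nonneg a
  map_mul_comm a b :=
    tendsto_nhds_unique ((h (a * b)).congr fun i => (hf i).map_mul_comm a b) (h (b * a))

theorem twoNorm_star (hφ : IsTrace φ) (a : B) : twoNorm φ (star a) = twoNorm φ a := by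
  rw [twoNorm, twoNorm, star_star, hφ.map_mul_comm]

theorem map_mul_star_mul_self (hφ : IsTrace φ) (a x : B) :
    φ (a * (star x * x)) = φ (x * a * star x) := by
  rw [← mul_assoc, hφ.map_mul_comm, mul_assoc, ← mul_assoc]

variable [PartialOrder B] [StarOrderedRing B]

theorem monotone (hφ : IsTrace φ) : Monotone φ := by
  refine fun a b hab => sub_nonneg.1 ?_
  obtain ⟨c, hc⟩ := CStarAlgebra.nonneg_iff_eq_star_mul_self.1 (sub_nonneg.2 hab)
  rw [← map_sub, hc]
  exact hφ.nonneg c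

theorem map_mul_nonneg (hφ : IsTrace φ) {a b : B} (ha : 0 ≤ a) (hb : 0 ≤ b) : 0 ≤ φ (a * b) := by
  obtain ⟨x, rfl⟩ := CStarAlgebra.nonneg_iff_eq_star_mul_self.1 hb
  rw [hφ.map_mul_star_mul_self]
  exact apply_nonneg_of_monotone hφ.monotone (star_right_conjugate_nonneg ha x)

theorem map_mul_le (hφ : IsTrace φ) {a b : B} (ha : 0 ≤ a) (ha1 : ‖a‖ ≤ 1) (hb : 0 ≤ b) :
    φ (a * b) ≤ φ b := by
  obtain ⟨x, rfl⟩ := CStarAlgebra.nonneg_iff_eq_star_mul_self.1 hb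
  rw [hφ.map_mul_star_mul_self, hφ.map_mul_comm (star x)]
  refine hφ.monotone ?_
  calc x * a * star x ≤ ‖a‖ • (x * star x) :=
        CStarAlgebra.star_right_conjugate_le_norm_smul (.of_nonneg ha)
    _ ≤ (1 : ℝ) • (x * star x) := smul_le_smul_of_nonneg_right ha1 (mul_star_self_nonneg x)
    _ = x * star x := one_smul ℝ _

theorem of_tendsto_mul (hψ : IsTrace ψ) {ι : Type*} {l : Filter ι} [l.NeBot] {a : ι → B}
    (ha : ∀ i, 0 ≤ a i)
    (hcomm : ∀ y, Tendsto (fun i => twoNorm ψ (a i * y - y * a i)) l (𝓝 0))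
    (hφ : ∀ x, Tendsto (fun i => ψ (a i * x)) l (𝓝 (φ x))) : IsTrace φ where
  nonneg x := ge_of_tendsto' (hφ _) fun i => hψ.map_mul_nonneg (ha i) (star_mul_self_nonneg x)
  map_mul_comm x y := by
    refine sub_eq_zero.1 (tendsto_nhds_unique ((hφ (x * y)).sub (hφ (y * x))) ?_)
    refine squeeze_zero_norm (fun i => ?_) (by simpa using (hcomm x).mul_const (twoNorm ψ y))
    have hsub : ψ (a i * (x * y)) - ψ (a i * (y * x)) = ψ ((a i * x - x * a i) * y) := by
      rw [← mul_assoc _ y, hψ.map_mul_comm _ x, ← map_sub, sub_mul, mul_assoc, mul_assoc]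
    have hcs := norm_apply_star_mul_le hψ.monotone (star (a i * x - x * a i)) y
    rwa [star_star, hψ.twoNorm_star, ← hsub] at hcs

theorem sub_of_tendsto_mul (hψ : IsTrace ψ) (hφ : IsTrace φ) {ι : Type*} {l : Filter ι} [l.NeBot]
    {a : ι → B} (ha : ∀ i, 0 ≤ a i) (ha1 : ∀ i, ‖a i‖ ≤ 1)
    (hlim : ∀ x, Tendsto (fun i => ψ (a i * x)) l (𝓝 (φ x))) : IsTrace (ψ - φ) where
  nonneg x := sub_nonneg.2 <| le_of_tendsto' (hlim _) fun i =>
    hψ.map_mul_le (ha i) (ha1 i) (star_mul_self_nonneg x)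
  map_mul_comm x y := congrArg₂ (· - ·) (hψ.map_mul_comm x y) (hφ.map_mul_comm x y)

open ComplexStarModule in
theorem twoNorm_realPart_le (hφ : IsTrace φ) (b : B) : twoNorm φ (ℜ b) ≤ twoNorm φ b := by
  refine Real.sqrt_le_sqrt ?_
  have h := congrArg (fun z => (φ z).re) (star_mul_self_add_self_mul_star b)
  have him := re_apply_nonneg_of_monotone hφ.monotone (ℑ b).2.mul_self_nonneg
  simp only [two_smul, map_add, Complex.add_re, hφ.map_mul_comm b] at h
  rw [(ℜ b).2.star_eq]
  linarith

end IsTrace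

/-! ### Approximate densities -/

theorem clamp_sq_sub_le {c : ℝ} (hc0 : 0 ≤ c) (hc2 : c ≤ 2) (x : ℝ) :
    max 0 (min 1 x) * max 0 (min 1 x) - c * max 0 (min 1 x) ≤ x * x - c * x := by
  rcases le_total x 0 with hx0 | hx0
  · rw [max_eq_left (min_le_of_right_le hx0)]
    nlinarith
  rcases le_total x 1 with hx1 | hx1
  · rw [min_eq_right hx1, max_eq_right hx0]
  · rw [min_eq_left hx1, max_eq_right zero_le_one]
    nlinarith

section ApproxDensity

variable {B : Type*} [NonUnitalCStarAlgebra B]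

/-- The quadratic functional `b ↦ ‖b‖₂² - 2 Re φ(b)`, with `‖b‖₂` the `2`-norm of `s`. If
`φ = s(h ·)` for a positive `h`, this is `‖b - h‖₂² - ‖h‖₂²`, so minimizing it amounts to
approximating the density `h` of `φ` with respect to `s`. -/
noncomputable def densityEnergy (φ s : B →L[ℂ] ℂ) (b : B) : ℝ :=
  twoNorm s b ^ 2 - 2 * (φ b).re

variable [PartialOrder B]

/-- A positive contraction `a` with `φ ≈ s(a ·)`, up to an error `δ` in the `2`-norm of `s`: an
approximate Radon-Nikodym derivative of `φ` with respect to `s`. -/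
structure IsApproxDensity (φ s : B →L[ℂ] ℂ) (δ : ℝ) (a : B) : Prop where
  nonneg : 0 ≤ a
  norm_le_one : ‖a‖ ≤ 1
  norm_sub_le : ∀ x, ‖s (a * x) - φ x‖ ≤ δ * twoNorm s x

variable [StarOrderedRing B] {φ s : B →L[ℂ] ℂ}

theorem exists_truncation {a : B} (ha : IsSelfAdjoint a) :
    ∃ b : B, 0 ≤ b ∧ ‖b‖ ≤ 1 ∧
      ∀ c : ℝ, 0 ≤ c → c ≤ 2 → b * b - c • b ≤ a * a - c • a := by
  have hclamp : ∀ x : ℝ, 0 ≤ max 0 (min 1 x) ∧ max 0 (min 1 x) ≤ 1 := fun x => by simp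
  have hpoly : ∀ (c : ℝ) (f : ℝ → ℝ), Continuous f → f 0 = 0 →
      cfcₙ f a * cfcₙ f a - c • cfcₙ f a = cfcₙ (fun x => f x * f x - c * f x) a :=
    fun c f hf hf0 => by
      rw [cfcₙ_sub _ _ a, cfcₙ_mul _ _ a, cfcₙ_const_mul c _ a]
  refine ⟨cfcₙ (fun x => max 0 (min 1 x)) a, cfcₙ_nonneg fun x _ => (hclamp x).1,
    norm_cfcₙ_le fun x _ => ?_, fun c hc0 hc2 => ?_⟩
  · rw [Real.norm_of_nonneg (hclamp x).1]
    exact (hclamp x).2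
  · have hid := hpoly c id continuous_id rfl
    rw [cfcₙ_id ℝ a] at hid
    rw [hpoly c _ (by fun_prop) (by simp), hid]
    exact cfcₙ_mono fun x _ => clamp_sq_sub_le hc0 hc2 x

theorem exists_densityEnergy_le (hφ : Monotone φ) (hsφ : Monotone (s - φ)) {a : B}
    (ha : IsSelfAdjoint a) :
    ∃ b : B, 0 ≤ b ∧ ‖b‖ ≤ 1 ∧ densityEnergy φ s b ≤ densityEnergy φ s a := by
  have hs : Monotone s := by simpa using hsφ.add hφ
  -- The energy of a self-adjoint `b` is `(s - φ)(b * b) + φ(b * b - 2 b)`.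
  obtain ⟨b, hb, hb1, hba⟩ := exists_truncation ha
  refine ⟨b, hb, hb1, ?_⟩
  have hsq := re_apply_le_of_monotone hsφ (hba 0 le_rfl zero_le_two)
  have hlin := re_apply_le_of_monotone hφ (hba 2 zero_le_two le_rfl)
  rw [densityEnergy, densityEnergy, sq_twoNorm hs, sq_twoNorm hs, ha.star_eq,
    (IsSelfAdjoint.of_nonneg hb).star_eq]
  simp only [zero_smul, sub_zero, sub_apply, two_smul, map_sub, map_add, Complex.sub_re,
    Complex.add_re] at hsq hlin
  linarith

theorem exists_densityEnergy_le_add (hφ : IsTrace φ) (hs : IsTrace s) (hsφ : Monotone (s - φ))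
    {ε : ℝ} (hε : 0 < ε) :
    ∃ a : B, 0 ≤ a ∧ ‖a‖ ≤ 1 ∧ ∀ b, densityEnergy φ s a ≤ densityEnergy φ s b + ε := by
  let S : Set ℝ := densityEnergy φ s '' {b | 0 ≤ b ∧ ‖b‖ ≤ 1}
  have hS : BddBelow S := by
    refine ⟨-(2 * ‖φ‖), ?_⟩
    rintro _ ⟨b, ⟨-, hb1⟩, rfl⟩
    rw [densityEnergy]
    linarith [re_apply_le_norm φ hb1, sq_nonneg (twoNorm s b)]
  obtain ⟨_, ⟨a, ⟨ha, ha1⟩, rfl⟩, hlt⟩ := exists_lt_of_csInf_lt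
    (show S.Nonempty from ⟨_, 0, ⟨le_rfl, by simp⟩, rfl⟩) (lt_add_of_pos_right (sInf S) hε)
  refine ⟨a, ha, ha1, fun b => hlt.le.trans ?_⟩
  have hre : densityEnergy φ s (realPart b) ≤ densityEnergy φ s b := by
    have hφre : (φ (realPart b)).re = (φ b).re := by
      rw [realPart_apply_coe, φ.map_smul_of_tower, map_add, apply_star_of_monotone hφ.monotone]
      simp [← two_mul]
    rw [densityEnergy, densityEnergy, hφre]
    gcongr
    exacts [twoNorm_nonneg _ _, hs.twoNorm_realPart_le b]
  obtain ⟨c, hc, hc1, hcb⟩ := exists_densityEnergy_le hφ.monotone hsφ (realPart b).2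
  linarith [csInf_le hS ⟨c, ⟨hc, hc1⟩, rfl⟩]

theorem densityEnergy_add_smul (hs : Monotone s) {a : B} (ha : IsSelfAdjoint a) (x : B) (t : ℝ) :
    densityEnergy φ s (a + t • x) =
      densityEnergy φ s a + 2 * (s (a * x) - φ x).re * t + twoNorm s x ^ 2 * (t * t) := by
  have hcross : (s (star x * a)).re = (s (a * x)).re := by
    have h := apply_star_of_monotone hs (a * x)
    rw [star_mul, ha.star_eq] at h
    rw [h, Complex.star_def, Complex.conj_re]
  simp only [densityEnergy, sq_twoNorm hs, star_add, star_smul, star_trivial, ha.star_eq, add_mul,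
    mul_add, smul_mul_assoc, mul_smul_comm, map_add, ContinuousLinearMap.map_smul_of_tower,
    Complex.add_re, Complex.sub_re, Complex.smul_re, smul_eq_mul, hcross]
  ring

theorem norm_sub_le_of_densityEnergy_le (hs : Monotone s) {a : B} (ha : IsSelfAdjoint a) {δ : ℝ}
    (hδ : 0 ≤ δ) (hmin : ∀ b, densityEnergy φ s a ≤ densityEnergy φ s b + δ ^ 2) (x : B) :
    ‖s (a * x) - φ x‖ ≤ δ * twoNorm s x := by
  have hre : ∀ y, (s (a * y) - φ y).re ≤ δ * twoNorm s y := fun y => by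
    have hquad : ∀ t : ℝ,
        0 ≤ twoNorm s y ^ 2 * (t * t) + 2 * (s (a * y) - φ y).re * t + δ ^ 2 := fun t => by
      have h := hmin (a + t • y)
      rw [densityEnergy_add_smul hs ha] at h
      linarith
    have hdiscrim := discrim_le_zero hquad
    rw [discrim] at hdiscrim
    exact le_of_sq_le_sq (by nlinarith) (mul_nonneg hδ (twoNorm_nonneg s y))
  obtain ⟨c, hc, hcx⟩ := Complex.exists_norm_eq_mul_self (s (a * x) - φ x)
  have hsmul : twoNorm s (c • x) = twoNorm s x := by
    rw [← norm_toPreGNS_eq_twoNorm hs, map_smul, norm_smul, hc, one_mul,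
      norm_toPreGNS_eq_twoNorm hs]
  have h := hre (c • x)
  rwa [mul_smul_comm, map_smul, map_smul, ← smul_sub, smul_eq_mul, ← hcx, Complex.ofReal_re,
    hsmul] at h

theorem exists_isApproxDensity (hφ : IsTrace φ) (hs : IsTrace s) (hsφ : Monotone (s - φ)) {δ : ℝ}
    (hδ : 0 < δ) : ∃ a, IsApproxDensity φ s δ a := by
  obtain ⟨a, ha, ha1, hmin⟩ := exists_densityEnergy_le_add hφ hs hsφ (pow_pos hδ 2)
  exact ⟨a, ha, ha1, norm_sub_le_of_densityEnergy_le hs.monotone (.of_nonneg ha) hδ.le hmin⟩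

theorem IsApproxDensity.twoNorm_commutator_le (hφ : IsTrace φ) (hs : IsTrace s) {δ : ℝ} {a : B}
    (hδ : 0 ≤ δ) (ha : IsApproxDensity φ s δ a) (y : B) :
    twoNorm s (a * y - y * a) ≤ 2 * δ * ‖y‖ := by
  -- `‖z‖₂² = s(a * w)` for a commutator `w`, on which the trace `φ ≈ s(a ·)` vanishes.
  set z := a * y - y * a with hz
  set w := y * star z - star z * y with hw
  have hφw : φ w = 0 := by rw [hw, map_sub, hφ.map_mul_comm, sub_self]
  have hsz : s (star z * z) = s (a * w) := by
    conv_lhs => rw [hz]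
    rw [hw, mul_sub, mul_sub, map_sub, map_sub, hs.map_mul_comm _ (a * y), ← mul_assoc (star z),
      hs.map_mul_comm _ a, mul_assoc]
  have hw2 : twoNorm s w ≤ 2 * ‖y‖ * twoNorm s z := by
    have h1 := twoNorm_mul_le hs.monotone y (star z)
    have h2 := twoNorm_mul_le hs.monotone (star y) z
    rw [← hs.twoNorm_star, star_mul, star_star, norm_star] at h2
    rw [hs.twoNorm_star] at h1
    linarith [twoNorm_sub_le hs.monotone (y * star z) (star z * y)]
  have hmul : twoNorm s z * twoNorm s z ≤ 2 * δ * ‖y‖ * twoNorm s z :=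
    calc twoNorm s z * twoNorm s z = (s (a * w) - φ w).re := by
          rw [← sq, sq_twoNorm hs.monotone, hsz, hφw, sub_zero]
      _ ≤ δ * twoNorm s w := (Complex.re_le_norm _).trans (ha.norm_sub_le w)
      _ ≤ δ * (2 * ‖y‖ * twoNorm s z) := by gcongr
      _ = 2 * δ * ‖y‖ * twoNorm s z := by ring
  rcases (twoNorm_nonneg s z).eq_or_lt with h0 | h0
  · rw [← h0]
    positivity
  · exact le_of_mul_le_mul_right hmul h0

end ApproxDensity

/-! ### Mutually singular traces -/

section Singular

/-- Mutual singularity of traces, the analogue of `φ ⟂ₘ ψ` for measures: `0` is the only trace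
dominated by both, where `χ` is dominated by `φ` if `φ - χ` is a trace. -/
def TraceSingular {B : Type*} [NonUnitalCStarAlgebra B] (φ ψ : B →L[ℂ] ℂ) : Prop :=
  ∀ χ : B →L[ℂ] ℂ, IsTrace χ → IsTrace (φ - χ) → IsTrace (ψ - χ) → χ = 0

variable {B : Type*} [NonUnitalCStarAlgebra B] {φ ψ χ : B →L[ℂ] ℂ}

theorem TraceSingular.mono_right (h : TraceSingular φ ψ) (hψχ : IsTrace (ψ - χ)) :
    TraceSingular φ χ := fun ω hω hφω hχω =>
  h ω hω hφω (by simpa using hψχ.add hχω)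

theorem TraceSingular.symm (h : TraceSingular φ ψ) : TraceSingular ψ φ :=
  fun χ hχ hψχ hφχ => h χ hχ hφχ hψχ

variable [PartialOrder B] [StarOrderedRing B]

/-- With `φ` having approximate densities `a i` with respect to `φ + ψ`, the common minorant is the
limit of `ψ (a i * ·)`, the analogue of `φψ / (φ + ψ)` for functions. -/
theorem exists_common_minorant (hφ : IsTrace φ) (hψ : IsTrace ψ) {ι : Type*} (V : Ultrafilter ι)
    {a : ι → B} {δ : ι → ℝ} (hδ0 : ∀ i, 0 ≤ δ i) (hδ : Tendsto δ V (𝓝 0))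
    (ha : ∀ i, IsApproxDensity φ (φ + ψ) (δ i) (a i)) :
    ∃ χ : B →L[ℂ] ℂ, IsTrace χ ∧ IsTrace (φ - χ) ∧ IsTrace (ψ - χ) ∧
      (∀ x, Tendsto (fun i => φ (a i * x)) V (𝓝 ((φ - χ) x))) ∧
      ∀ x, Tendsto (fun i => ψ (a i * x)) V (𝓝 (χ x)) := by
  have hs : IsTrace (φ + ψ) := hφ.add hψ
  obtain ⟨χ, -, hχ⟩ := exists_norm_le_forall_tendsto V
    (f := fun i => ψ.comp (ContinuousLinearMap.mul ℂ B (a i))) (C := ‖ψ‖) fun i =>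
      (ψ.opNorm_comp_le _).trans <| mul_le_of_le_one_right (norm_nonneg ψ) <|
        (ContinuousLinearMap.opNorm_mul_apply_le ℂ B (a i)).trans (ha i).norm_le_one
  replace hχ : ∀ x, Tendsto (fun i => ψ (a i * x)) V (𝓝 (χ x)) := hχ
  have hφχ : ∀ x, Tendsto (fun i => φ (a i * x)) V (𝓝 ((φ - χ) x)) := fun x => by
    have hdiff : Tendsto (fun i => (φ + ψ) (a i * x) - φ x) V (𝓝 0) :=
      squeeze_zero_norm (fun i => (ha i).norm_sub_le x)
        (by simpa using hδ.mul_const (twoNorm (φ + ψ) x))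
    simpa [sub_eq_add_neg] using (hdiff.add_const (φ x)).sub (hχ x)
  have hcomm : ∀ ω : B →L[ℂ] ℂ, Monotone (φ + ψ - ω) → ∀ y,
      Tendsto (fun i => twoNorm ω (a i * y - y * a i)) V (𝓝 0) := fun ω hω y =>
    squeeze_zero (fun i => twoNorm_nonneg ω _)
      (fun i => (twoNorm_le_of_monotone_sub hω _).trans <|
        (ha i).twoNorm_commutator_le hφ hs (hδ0 i) y)
      (by simpa using (hδ.const_mul 2).mul_const ‖y‖)
  have hχt : IsTrace χ :=
    hψ.of_tendsto_mul (fun i => (ha i).nonneg) (hcomm ψ (by simpa using hφ.monotone)) hχ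
  have hφχt : IsTrace (φ - χ) :=
    hφ.of_tendsto_mul (fun i => (ha i).nonneg) (hcomm φ (by simpa using hψ.monotone)) hφχ
  exact ⟨χ, hχt, hφχt,
    hψ.sub_of_tendsto_mul hχt (fun i => (ha i).nonneg) (fun i => (ha i).norm_le_one) hχ, hφχ, hχ⟩

theorem TraceSingular.exists_tendsto_mul (h : TraceSingular φ ψ) (hφ : IsTrace φ)
    (hψ : IsTrace ψ) :
    ∃ a : ℕ → B, (∀ n, 0 ≤ a n) ∧ (∀ n, ‖a n‖ ≤ 1) ∧
      (∀ x, Tendsto (fun n => φ (a n * x)) atTop (𝓝 (φ x))) ∧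
      ∀ x, Tendsto (fun n => ψ (a n * x)) atTop (𝓝 0) := by
  have hpos : ∀ n : ℕ, 0 < 1 / ((n : ℝ) + 1) := fun n => Nat.one_div_pos_of_nat
  have hψ' : Monotone (φ + ψ - φ) := by simpa using hψ.monotone
  choose a ha using fun n : ℕ => exists_isApproxDensity hφ (hφ.add hψ) hψ' (hpos n)
  have hlim : ∀ V : Ultrafilter ℕ, (V : Filter ℕ) ≤ atTop → ∀ x,
      Tendsto (fun n => φ (a n * x)) V (𝓝 (φ x)) ∧ Tendsto (fun n => ψ (a n * x)) V (𝓝 0) := by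
    intro V hV x
    obtain ⟨χ, hχ, hφχ, hψχ, hφlim, hψlim⟩ := exists_common_minorant hφ hψ V
      (fun n => (hpos n).le) (tendsto_one_div_add_atTop_nhds_zero_nat.mono_left hV) ha
    obtain rfl := h χ hχ hφχ hψχ
    exact ⟨by simpa using hφlim x, hψlim x⟩
  exact ⟨a, fun n => (ha n).nonneg, fun n => (ha n).norm_le_one,
    fun x => tendsto_iff_ultrafilter _ _ _ |>.2 fun V hV => (hlim V hV x).1,
    fun x => tendsto_iff_ultrafilter _ _ _ |>.2 fun V hV => (hlim V hV x).2⟩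

theorem TraceSingular.isTrace_sub (h : TraceSingular χ ψ) (hφ : IsTrace φ) (hψ : IsTrace ψ)
    (hχ : IsTrace χ) (hsub : IsTrace (φ + ψ - χ)) : IsTrace (φ - χ) where
  nonneg x := by
    obtain ⟨a, ha, ha1, hχlim, hψlim⟩ := h.exists_tendsto_mul hχ hψ
    have hx : 0 ≤ star x * x := star_mul_self_nonneg x
    refine ge_of_tendsto' (x := atTop) (f := fun n =>
      φ (star x * x) + ψ (a n * (star x * x)) - χ (a n * (star x * x))) ?_ fun n => ?_
    · simpa using ((hψlim (star x * x)).const_add (φ (star x * x))).sub (hχlim (star x * x))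
    · calc (0 : ℂ) ≤ (φ + ψ - χ) (a n * (star x * x)) := hsub.map_mul_nonneg (ha n) hx
        _ ≤ _ := sub_le_sub_right (add_le_add_left (hφ.map_mul_le (ha n) (ha1 n) hx) _) _
  map_mul_comm x y := congrArg₂ (· - ·) (hφ.map_mul_comm x y) (hχ.map_mul_comm x y)

theorem TraceSingular.add_left {φ' : B →L[ℂ] ℂ} (h : TraceSingular φ ψ) (h' : TraceSingular φ' ψ)
    (hφ : IsTrace φ) (hφ' : IsTrace φ') : TraceSingular (φ + φ') ψ := fun χ hχ hsub hψχ =>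
  h χ hχ ((h'.mono_right hψχ).symm.isTrace_sub hφ hφ' hχ hsub) hψχ

theorem TraceSingular.sum_left {ι : Type*} {f : ι → B →L[ℂ] ℂ} (s : Finset ι)
    (hf : ∀ i ∈ s, IsTrace (f i)) (h : ∀ i ∈ s, TraceSingular (f i) ψ) :
    TraceSingular (∑ i ∈ s, f i) ψ := by
  induction s using Finset.cons_induction with
  | empty =>
    intro χ hχ hsub _
    have hnorm := norm_add_norm_sub_of_monotone hχ.monotone hsub.monotone
    rw [Finset.sum_empty, norm_zero] at hnorm
    exact norm_le_zero_iff.1 (by linarith [norm_nonneg (0 - χ)])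
  | cons i s hi ih =>
    simp only [Finset.forall_mem_cons] at hf h
    rw [Finset.sum_cons]
    exact h.1.add_left (ih hf.2 h.2) hf.1 (.sum s hf.2)

/-- Choose `u = v⋆v` with `φ(u)` close to `‖φ‖`. The traces `φ` and `ψ` take the values `φ(a * u)`
and `ψ(a * u)` at the positive contraction `v * a * v⋆`. -/
theorem TraceSingular.exists_separating (h : TraceSingular φ ψ) (hφ : IsTrace φ) (hψ : IsTrace ψ)
    {ε : ℝ} (hε : 0 < ε) : ∃ e : B, 0 ≤ e ∧ ‖e‖ ≤ 1 ∧ ‖φ‖ - ε < (φ e).re ∧ (ψ e).re < ε := by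
  obtain ⟨a, ha, ha1, hφlim, hψlim⟩ := h.exists_tendsto_mul hφ hψ
  have hunit := CStarAlgebra.increasingApproximateUnit B
  obtain ⟨u, hφu, hu, hu1⟩ := ((tendsto_re_approximateUnit hφ.monotone).eventually_const_lt
    (sub_lt_self ‖φ‖ hε) |>.and (hunit.eventually_nonneg.and hunit.eventually_norm)).exists
  obtain ⟨v, rfl⟩ := CStarAlgebra.nonneg_iff_eq_star_mul_self.1 hu
  have hre := fun z : ℂ => Complex.continuous_re.tendsto z
  obtain ⟨n, hφn, hψn⟩ := (((hre _).comp (hφlim _)).eventually_const_lt hφu |>.and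
    (((hre _).comp (hψlim (star v * v))).eventually_lt_const hε)).exists
  refine ⟨v * a n * star v, star_right_conjugate_nonneg (ha n) v, ?_, ?_, ?_⟩
  · rw [CStarRing.norm_star_mul_self] at hu1
    calc ‖v * a n * star v‖ ≤ ‖v‖ * ‖a n‖ * ‖star v‖ := norm_mul₃_le
      _ = ‖a n‖ * (‖v‖ * ‖v‖) := by rw [norm_star]; ring
      _ ≤ 1 := mul_le_one₀ (ha1 n) (by positivity) hu1
  · rwa [← hφ.map_mul_star_mul_self]
  · rwa [← hψ.map_mul_star_mul_self]

end Singular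

/-! ### Extremal tracial states -/

section Extremal

variable {B : Type*} [NonUnitalCStarAlgebra B] {φ ψ χ : B →L[ℂ] ℂ}

theorem IsTrace.inv_norm_smul_mem_tracialStates (hφ : IsTrace φ) (h0 : φ ≠ 0) :
    ‖φ‖⁻¹ • φ ∈ tracialStates B :=
  ⟨hφ.smul (by positivity), by
    rw [norm_smul, norm_inv, norm_norm, inv_mul_cancel₀ (norm_ne_zero_iff.2 h0)]⟩

variable [PartialOrder B] [StarOrderedRing B]

theorem eq_norm_smul_of_mem_extremalTracialStates (hφ : φ ∈ extremalTracialStates B)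
    (hχ : IsTrace χ) (hφχ : IsTrace (φ - χ)) : χ = ‖χ‖ • φ := by
  have hsum := norm_add_norm_sub_of_monotone hχ.monotone hφχ.monotone
  rw [hφ.1.2] at hsum
  rcases eq_or_ne χ 0 with rfl | hχ0
  · rw [norm_zero]
    exact (zero_smul ℝ φ).symm
  rcases eq_or_ne (φ - χ) 0 with hφχ0 | hφχ0
  · rw [hφχ0, norm_zero, add_zero] at hsum
    rw [hsum, one_smul, sub_eq_zero.1 hφχ0]
  have hχ0' : ‖χ‖ ≠ 0 := norm_ne_zero_iff.2 hχ0
  have hφχ0' : ‖φ - χ‖ ≠ 0 := norm_ne_zero_iff.2 hφχ0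
  have hmem : φ ∈ openSegment ℝ (‖χ‖⁻¹ • χ) (‖φ - χ‖⁻¹ • (φ - χ)) :=
    ⟨‖χ‖, ‖φ - χ‖, by positivity, by positivity, hsum, by
      rw [smul_inv_smul₀ hχ0', smul_inv_smul₀ hφχ0', add_sub_cancel]⟩
  rw [← hφ.2 (hχ.inv_norm_smul_mem_tracialStates hχ0)
    (hφχ.inv_norm_smul_mem_tracialStates hφχ0) hmem, smul_inv_smul₀ hχ0']

theorem traceSingular_of_mem_extremalTracialStates (hφ : φ ∈ extremalTracialStates B)
    (hψ : ψ ∈ extremalTracialStates B) (hne : φ ≠ ψ) : TraceSingular φ ψ := by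
  refine fun χ hχ hφχ hψχ => not_not.1 fun hχ0 => hne ?_
  refine smul_right_injective _ (norm_ne_zero_iff.2 hχ0) ?_
  exact (eq_norm_smul_of_mem_extremalTracialStates hφ hχ hφχ).symm.trans
    (eq_norm_smul_of_mem_extremalTracialStates hψ hχ hψχ)

theorem exists_separating_finset {s : Finset (B →L[ℂ] ℂ)} (hs : ∀ f ∈ s, f ∈ tracialStates B)
    (hψ : IsTrace ψ) (hsψ : ∀ f ∈ s, TraceSingular f ψ) {ε : ℝ} (hε : 0 < ε) :
    ∃ e : B, 0 ≤ e ∧ ‖e‖ ≤ 1 ∧ (∀ f ∈ s, 1 - ε < (f e).re) ∧ (ψ e).re < ε := by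
  have htrace : ∀ f ∈ s, IsTrace f := fun f hf => (hs f hf).1
  obtain ⟨e, he, he1, hsum, hψe⟩ :=
    (TraceSingular.sum_left s htrace hsψ).exists_separating (.sum s htrace) hψ hε
  refine ⟨e, he, he1, fun f hf => ?_, hψe⟩
  have hcard : ‖∑ f ∈ s, f‖ = s.card := by
    rw [norm_sum_of_monotone s fun f hf => (htrace f hf).monotone,
      Finset.sum_congr rfl fun f hf => (hs f hf).2]
    simp
  have hle : ∀ g ∈ s, (g e).re ≤ 1 := fun g hg => (hs g hg).2 ▸ re_apply_le_norm g he1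
  have hdefect : 1 - (f e).re ≤ ∑ g ∈ s, (1 - (g e).re) :=
    Finset.single_le_sum (f := fun g : B →L[ℂ] ℂ => 1 - (g e).re)
      (fun g hg => sub_nonneg.2 (hle g hg)) hf
  rw [hcard, sum_apply, Complex.re_sum] at hsum
  rw [Finset.sum_sub_distrib, Finset.sum_const, nsmul_eq_mul, mul_one] at hdefect
  linarith

/-- A trace `ψ` can fail to be singular to extremal tracial states. If it fails for `φ₀`, then `ψ`
dominates a multiple `c φ₀`, and any `e` separating the other extremal tracial states from `φ₀`
satisfies `ψ(e) ≤ (1 - c) + c φ₀(e) < 1`. -/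
theorem exists_separating_of_forall_ne (hψ : IsTrace ψ) (hψ1 : ‖ψ‖ ≤ 1) :
    ∃ (φ₀ : B →L[ℂ] ℂ) (α β : ℝ), α < β ∧ ∀ s : Finset (B →L[ℂ] ℂ),
      (∀ f ∈ s, f ∈ extremalTracialStates B ∧ f ≠ φ₀) →
        ∃ e : B, ‖e‖ ≤ 1 ∧ (ψ e).re ≤ α ∧ ∀ f ∈ s, β ≤ (f e).re := by
  by_cases hsing : ∀ φ ∈ extremalTracialStates B, TraceSingular φ ψ
  · refine ⟨0, 1 / 4, 1 - 1 / 4, by norm_num, fun s hs => ?_⟩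
    obtain ⟨e, -, he1, hse, hψe⟩ := exists_separating_finset (fun f hf => (hs f hf).1.1) hψ
      (fun f hf => hsing f (hs f hf).1) (show (0 : ℝ) < 1 / 4 by norm_num)
    exact ⟨e, he1, hψe.le, fun f hf => (hse f hf).le⟩
  · simp only [TraceSingular, not_forall] at hsing
    obtain ⟨φ₀, hφ₀, χ, hχ, hφ₀χ, hψχ, hχ0⟩ := hsing
    set c := ‖χ‖ with hc
    have hc0 : 0 < c := norm_pos_iff.2 hχ0
    have hsum := norm_add_norm_sub_of_monotone hχ.monotone hψχ.monotone
    have hc1 : c ≤ 1 := by linarith [norm_nonneg (ψ - χ)]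
    refine ⟨φ₀, 1 - c + c * (c / 4), 1 - c / 4, by nlinarith, fun s hs => ?_⟩
    obtain ⟨e, -, he1, hse, hφ₀e⟩ := exists_separating_finset (fun f hf => (hs f hf).1.1) hφ₀.1.1
      (fun f hf => traceSingular_of_mem_extremalTracialStates (hs f hf).1 hφ₀ (hs f hf).2)
      (show 0 < c / 4 by positivity)
    refine ⟨e, he1, ?_, fun f hf => (hse f hf).le⟩
    have hχe : (χ e).re = c * (φ₀ e).re := by
      conv_lhs => rw [eq_norm_smul_of_mem_extremalTracialStates hφ₀ hχ hφ₀χ]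
      simp [hc]
    calc (ψ e).re = ((ψ - χ) e).re + c * (φ₀ e).re := by simp [hχe]
      _ ≤ 1 - c + c * (c / 4) := by
        gcongr
        linarith [re_apply_le_norm (ψ - χ) he1]

theorem exists_separating_seq {φ : ℕ → B →L[ℂ] ℂ} (hφ : ∀ j, φ j ∈ extremalTracialStates B)
    (hinj : Function.Injective φ) (hψ : IsTrace ψ) (hψ1 : ‖ψ‖ ≤ 1) :
    ∃ (α β : ℝ) (e : ℕ → B), α < β ∧ (∀ k, ‖e k‖ ≤ 1) ∧ (∀ k, (ψ (e k)).re ≤ α) ∧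
      ∀ᶠ j in cofinite, ∀ᶠ k in atTop, β ≤ (φ j (e k)).re := by
  classical
  obtain ⟨φ₀, α, β, hαβ, hsep⟩ := exists_separating_of_forall_ne hψ hψ1
  choose e he hψe hφe using fun k : ℕ =>
    hsep (((Finset.range k).image φ).erase φ₀) fun f hf => by
      obtain ⟨hne, hmem⟩ := Finset.mem_erase.1 hf
      obtain ⟨j, -, rfl⟩ := Finset.mem_image.1 hmem
      exact ⟨hφ j, hne⟩
  refine ⟨α, β, e, hαβ, he, hψe, ?_⟩
  have hne : ∀ᶠ j in cofinite, φ j ≠ φ₀ :=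
    hinj.tendsto_cofinite.eventually (eventually_cofinite_ne φ₀)
  filter_upwards [hne] with j hj
  filter_upwards [eventually_gt_atTop j] with k hk
  exact hφe k _ (Finset.mem_erase.2 ⟨hj, Finset.mem_image_of_mem φ (Finset.mem_range.2 hk)⟩)

end Extremal

/-! ### Ultralimits of functionals -/

section Ultralimit

variable {A : Type*} [NonUnitalCStarAlgebra A] {U : Ultrafilter ℕ}

/-- The bounded sequence `a`, with bound `C`, as an element of `ℓ^∞(A)`. -/
def boundedSeq (a : ℕ → A) {C : ℝ} (ha : ∀ n, ‖a n‖ ≤ C) : lp (fun _ : ℕ => A) ∞ :=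
  ⟨a, memℓp_infty ⟨C, Set.forall_mem_range.2 ha⟩⟩

theorem exists_isUltralimit (U : Ultrafilter ℕ) {σ : ℕ → A →L[ℂ] ℂ} {C : ℝ}
    (hσ : ∀ n, ‖σ n‖ ≤ C) :
    ∃ Φ : CStarUltrapower U A →L[ℂ] ℂ, ‖Φ‖ ≤ C ∧ IsUltralimit U σ Φ := by
  have hC : 0 ≤ C := (norm_nonneg _).trans (hσ 0)
  let f : ℕ → lp (fun _ : ℕ => A) ∞ →L[ℂ] ℂ := fun n =>
    (σ n).comp (lp.evalCLM ℂ (fun _ : ℕ => A) ∞ n)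
  have hf : ∀ n, ‖f n‖ ≤ C := fun n =>
    (f n).opNorm_le_bound hC fun a =>
      (σ n).le_of_opNorm_le_of_le (hσ n) (CStarUltrapower.norm_coe_le a n)
  obtain ⟨F, -, hF⟩ := exists_norm_le_forall_tendsto U hf
  have hbound : ∀ a, ‖F a‖ ≤ C * ‖CStarUltrapower.mk U A a‖ := fun a =>
    le_of_tendsto_of_tendsto' (hF a).norm ((CStarUltrapower.tendsto_norm a).const_mul C)
      fun n => (σ n).le_of_opNorm_le (hσ n) (a n)
  let G : CStarUltrapower U A →ₗ[ℂ] ℂ :=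
    (CStarUltrapower.nullSeq U A).liftQ (F : lp (fun _ : ℕ => A) ∞ →ₗ[ℂ] ℂ) fun a ha => by
      have hmk : CStarUltrapower.mk U A a = 0 := (Submodule.Quotient.mk_eq_zero _).2 ha
      simpa [hmk] using hbound a
  have hG : ∀ x, ‖G x‖ ≤ C * ‖x‖ := fun x => by
    obtain ⟨a, rfl⟩ := CStarUltrapower.mk_surjective x
    exact hbound a
  exact ⟨G.mkContinuous C hG, G.mkContinuous_norm_le hC hG, hF⟩

namespace IsUltralimit

variable {σ : ℕ → A →L[ℂ] ℂ} {φ : A →L[ℂ] ℂ} {τ : CStarUltrapower U A →L[ℂ] ℂ}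

theorem isTrace (h : IsUltralimit U σ τ) (hσ : ∀ n, IsTrace (σ n)) : IsTrace τ where
  nonneg x := by
    obtain ⟨a, rfl⟩ := CStarUltrapower.mk_surjective x
    exact ge_of_tendsto' (h (star a * a)) fun n => (hσ n).nonneg (a n)
  map_mul_comm x y := by
    obtain ⟨a, rfl⟩ := CStarUltrapower.mk_surjective x
    obtain ⟨b, rfl⟩ := CStarUltrapower.mk_surjective y
    exact tendsto_nhds_unique ((h (a * b)).congr fun n => (hσ n).map_mul_comm (a n) (b n))
      (h (b * a))

theorem smul (h : IsUltralimit U σ τ) (c : ℝ) : IsUltralimit U (fun n => c • σ n) (c • τ) :=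
  fun a => (h a).const_smul c

theorem apply_mk_const (h : IsUltralimit U (fun _ => φ) τ) (a : A) :
    τ (CStarUltrapower.mk U A (boundedSeq (fun _ => a) fun _ => le_rfl)) = φ a :=
  tendsto_nhds_unique (h (boundedSeq (fun _ => a) fun _ => le_rfl)) tendsto_const_nhds

theorem re_apply_mk_le (h : IsUltralimit U σ τ) {a : lp (fun _ : ℕ => A) ∞} {γ : ℝ}
    (ha : ∀ᶠ n in U, (σ n (a n)).re ≤ γ) : (τ (CStarUltrapower.mk U A a)).re ≤ γ :=
  le_of_tendsto ((Complex.continuous_re.tendsto _).comp (h a)) ha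

theorem le_re_apply_mk (h : IsUltralimit U σ τ) {a : lp (fun _ : ℕ => A) ∞} {γ : ℝ}
    (ha : ∀ᶠ n in U, γ ≤ (σ n (a n)).re) : γ ≤ (τ (CStarUltrapower.mk U A a)).re :=
  ge_of_tendsto ((Complex.continuous_re.tendsto _).comp (h a)) ha

end IsUltralimit

theorem exists_tendsto_atTop_eventually {l : Filter ℕ} (hl : l ≤ atTop) {p : ℕ → ℕ → Prop}
    (hp : ∀ k, ∀ᶠ n in l, p k n) :
    ∃ k : ℕ → ℕ, Tendsto k l atTop ∧ ∀ᶠ n in l, p (k n) n := by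
  classical
  refine ⟨fun n => Nat.findGreatest (p · n) n, tendsto_atTop.2 fun K => ?_, ?_⟩
  · filter_upwards [hp K, hl (Ici_mem_atTop K)] with n hn hKn
    exact Nat.le_findGreatest hKn hn
  · filter_upwards [hp 0] with n hn
    exact Nat.findGreatest_spec (P := (p · n)) n.zero_le hn

theorem IsUltralimit.exists_tendsto_re_apply_le (hU : (U : Filter ℕ) ≤ atTop)
    {σ : ℕ → A →L[ℂ] ℂ} {τ : CStarUltrapower U A →L[ℂ] ℂ} (h : IsUltralimit U σ τ) {e : ℕ → A}
    {C γ : ℝ} (he : ∀ k, ‖e k‖ ≤ C)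
    (hγ : ∀ k, (τ (CStarUltrapower.mk U A (boundedSeq (fun _ => e k) fun _ => le_rfl))).re < γ) :
    ∃ k : ℕ → ℕ, Tendsto k U atTop ∧
      (τ (CStarUltrapower.mk U A (boundedSeq (fun n => e (k n)) fun n => he (k n)))).re ≤ γ := by
  have hev : ∀ k, ∀ᶠ n in U, (σ n (e k)).re ≤ γ := fun k =>
    (((Complex.continuous_re.tendsto _).comp (h _)).eventually_lt_const (hγ k)).mono
      fun _ => le_of_lt
  obtain ⟨k, hk, hkγ⟩ := exists_tendsto_atTop_eventually hU hev
  exact ⟨k, hk, h.re_apply_mk_le hkγ⟩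

theorem le_re_apply_mk_of_tendsto_atTop {V : Filter ℕ} [V.NeBot]
    {φ : ℕ → A →L[ℂ] ℂ} {Φ : ℕ → CStarUltrapower U A →L[ℂ] ℂ}
    (hΦ : ∀ j, IsUltralimit U (fun _ => φ j) (Φ j)) {τ : CStarUltrapower U A →L[ℂ] ℂ}
    (hτ : ∀ x, Tendsto (fun j => Φ j x) V (𝓝 (τ x))) {e : ℕ → A} {C β : ℝ} (he : ∀ k, ‖e k‖ ≤ C)
    (hφe : ∀ᶠ j in V, ∀ᶠ k in atTop, β ≤ (φ j (e k)).re) {k : ℕ → ℕ}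
    (hk : Tendsto k U atTop) :
    β ≤ (τ (CStarUltrapower.mk U A (boundedSeq (fun n => e (k n)) fun n => he (k n)))).re := by
  refine ge_of_tendsto ((Complex.continuous_re.tendsto _).comp (hτ _)) ?_
  filter_upwards [hφe] with j hj
  exact (hΦ j).le_re_apply_mk (hk.eventually hj)

theorem not_isUltralimit_of_separated (hU : (U : Filter ℕ) ≤ atTop) {V : Filter ℕ} [V.NeBot]
    {φ : ℕ → A →L[ℂ] ℂ} {ψ : A →L[ℂ] ℂ}
    (hψ : ∀ a, Tendsto (fun j => φ j a) V (𝓝 (ψ a)))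
    {Φ : ℕ → CStarUltrapower U A →L[ℂ] ℂ} (hΦ : ∀ j, IsUltralimit U (fun _ => φ j) (Φ j))
    {τ : CStarUltrapower U A →L[ℂ] ℂ} (hτ : ∀ x, Tendsto (fun j => Φ j x) V (𝓝 (τ x)))
    {e : ℕ → A} {C α β : ℝ} (hαβ : α < β) (he : ∀ k, ‖e k‖ ≤ C)
    (hψe : ∀ k, (ψ (e k)).re ≤ α)
    (hφe : ∀ᶠ j in V, ∀ᶠ k in atTop, β ≤ (φ j (e k)).re) (σ : ℕ → A →L[ℂ] ℂ) :
    ¬ IsUltralimit U σ τ := by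
  intro hσ
  obtain ⟨γ, hαγ, hγβ⟩ := exists_between hαβ
  have hconst : ∀ a : A,
      τ (CStarUltrapower.mk U A (boundedSeq (fun _ => a) fun _ => le_rfl)) = ψ a := fun a =>
    tendsto_nhds_unique (hτ _) ((hψ a).congr fun j => ((hΦ j).apply_mk_const a).symm)
  obtain ⟨k, hk, hkγ⟩ := hσ.exists_tendsto_re_apply_le hU he fun k => by
    rw [hconst]
    exact (hψe k).trans_lt hαγ
  exact hγβ.not_ge ((le_re_apply_mk_of_tendsto_atTop hΦ hτ he hφe hk).trans hkγ)

end Ultralimit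

theorem mainTheorem2_general {A : Type*} [NonUnitalCStarAlgebra A]
    (U : Ultrafilter ℕ) (hU : ∀ n : ℕ, U ≠ pure n)
    (hA : (extremalTracialStates A).Infinite) :
    ∃ τ ∈ tracialStates (CStarUltrapower U A),
      ∀ σ : ℕ → A →L[ℂ] ℂ, ¬ IsUltralimit U σ τ := by
  let _ := CStarAlgebra.spectralOrder A
  have := CStarAlgebra.spectralOrderedRing A
  have hUcof : (U : Filter ℕ) ≤ cofinite :=
    U.le_cofinite_or_eq_pure.resolve_right fun ⟨n, hn⟩ => hU n hn
  let φ : ℕ → A →L[ℂ] ℂ := fun j => hA.natEmbedding _ j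
  have hφ : ∀ j, φ j ∈ extremalTracialStates A := fun j => (hA.natEmbedding _ j).2
  have hφ1 : ∀ j, ‖φ j‖ ≤ 1 := fun j => (hφ j).1.2.le
  have hinj : φ.Injective := Subtype.val_injective.comp (hA.natEmbedding _).injective
  obtain ⟨ψ, hψ1, hψ⟩ := exists_norm_le_forall_tendsto U hφ1
  choose Φ hΦ1 hΦ using fun j => exists_isUltralimit U fun _ => hφ1 j
  obtain ⟨τ, -, hτ⟩ := exists_norm_le_forall_tendsto U hΦ1
  have hψt : IsTrace ψ := .of_tendsto (fun j => (hφ j).1.1) hψ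
  have hτt : IsTrace τ := .of_tendsto (fun j => (hΦ j).isTrace fun _ => (hφ j).1.1) hτ
  obtain ⟨α, β, e, hαβ, he, hψe, hφe⟩ := exists_separating_seq hφ hinj hψt hψ1
  have hnot := not_isUltralimit_of_separated (hUcof.trans_eq Nat.cofinite_eq_atTop) hψ hΦ hτ hαβ he
    hψe (hUcof hφe)
  have hτ0 : τ ≠ 0 := by
    rintro rfl
    exact hnot 0 fun _ => tendsto_const_nhds
  refine ⟨‖τ‖⁻¹ • τ, hτt.inv_norm_smul_mem_tracialStates hτ0, fun σ hσ => ?_⟩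
  exact hnot _ (by simpa [smul_inv_smul₀ (norm_ne_zero_iff.2 hτ0)] using hσ.smul ‖τ‖)

theorem mainTheorem2 {A : Type*} [NonUnitalCStarAlgebra A]
    (U : Ultrafilter ℕ) (hU : ∀ n : ℕ, U ≠ pure n)
    (hA : (extremalTracialStates A).Infinite) :
    ∃ τ ∈ tracialStates (CStarUltrapower U A),
      ∀ σ : ℕ → A →L[ℂ] ℂ, (∀ n, IsTrace (σ n)) → ¬ IsUltralimit U σ τ := by
  obtain ⟨τ, hτ, hτσ⟩ := mainTheorem2_general U hU hA
  exact ⟨τ, hτ, fun σ _ => hτσ σ⟩
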